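/- For real numbers $a>0$ and $b\in(0,1)$ let $f_{a,b}:[0,1]\to[0,1]$ be the map \[ f_{a,b}(x)=\frac{x}{x+(1-x)\exp(a(x-b))}. \] If $X$ is a compact metric space with metric $\rho$ and $f:X\to X$ is continuous, a pair $x,y\in X$ is called a Li--Yorke pair if $\liminf_{n\to\infty}\rho(f^n(x),f^n(y))=0$ and $\limsup_{n\to\infty}\rho(f^n(x),f^n(y))>0$; the map $f$ is Li--Yorke chaotic if there is an uncountable set $S\subset X$ (a scrambled set) such that every pair $x,y\in S$ with $x\neq y$ is a Li--Yorke pair. **Corollary.** For every $b\in(0,1)\setminus\{1/2\}$ there exists $a_b>0$ such that for every $a>a_b$ the map $f_{a,b}$ has periodic orbits of all periods (for every integer $n\ge 1$ there is a point of $[0,1]$ whose least period under $f_{a,b}$ is $n$) and is (continuous and) Li--Yorke chaotic. -/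

import Mathlib

/-- Two points form a Li-Yorke pair for `f` if their orbits are proximal but not asymptotic. On a
compact metric space the sequence of distances is bounded, so both real limits are genuine. -/
def IsLiYorkePair {X : Type*} [MetricSpace X] [CompactSpace X] (f : X → X) (x y : X) : Prop :=
  Filter.liminf (fun n : ℕ => dist (f^[n] x) (f^[n] y)) Filter.atTop = 0 ∧
    0 < Filter.limsup (fun n : ℕ => dist (f^[n] x) (f^[n] y)) Filter.atTop

/-- A set is scrambled for `f` if any two distinct points of it form a Li-Yorke pair. -/
def IsScrambledSet {X : Type*} [MetricSpace X] [CompactSpace X] (f : X → X) (S : Set X) : Prop :=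
  ∀ x ∈ S, ∀ y ∈ S, x ≠ y → IsLiYorkePair f x y

/-- A continuous self-map of a compact metric space is Li-Yorke chaotic if it has an uncountable
scrambled set. -/
def IsLiYorkeChaotic {X : Type*} [MetricSpace X] [CompactSpace X] (f : X → X) : Prop :=
  Continuous f ∧ ∃ S : Set X, ¬ S.Countable ∧ IsScrambledSet f S

/-- `f` has periodic orbits of all periods: for each `n ≥ 1` there is a point whose least period
is `n`. -/
def HasPeriodicOrbitsOfAllPeriods {X : Type*} (f : X → X) : Prop :=
  ∀ n : ℕ, 1 ≤ n → ∃ x : X, Function.minimalPeriod f x = n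

/-- The formula `x / (x + (1 - x) exp (a (x - b)))`. -/
noncomputable def gameMapFormula (a b x : ℝ) : ℝ :=
  x / (x + (1 - x) * Real.exp (a * (x - b)))

theorem gameMapFormula_denom_pos (a b : ℝ) {x : ℝ} (hx : x ∈ Set.Icc (0 : ℝ) 1) :
    0 < x + (1 - x) * Real.exp (a * (x - b)) := by
  rcases hx.1.eq_or_lt with h | h
  · subst h
    simpa using Real.exp_pos _
  · have := mul_nonneg (sub_nonneg.2 hx.2) (Real.exp_pos (a * (x - b))).le
    linarith

theorem gameMapFormula_mem (a b : ℝ) {x : ℝ} (hx : x ∈ Set.Icc (0 : ℝ) 1) :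
    gameMapFormula a b x ∈ Set.Icc (0 : ℝ) 1 := by
  have hpos := gameMapFormula_denom_pos a b hx
  have := mul_nonneg (sub_nonneg.2 hx.2) (Real.exp_pos (a * (x - b))).le
  refine ⟨div_nonneg hx.1 hpos.le, ?_⟩
  rw [gameMapFormula, div_le_one hpos]
  linarith

/-- The map `f_{a,b} : [0,1] → [0,1]`, `f_{a,b}(x) = x / (x + (1 - x) exp (a (x - b)))`. -/
noncomputable def gameMap (a b : ℝ) (x : Set.Icc (0 : ℝ) 1) : Set.Icc (0 : ℝ) 1 :=
  ⟨gameMapFormula a b x, gameMapFormula_mem a b x.2⟩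

/-! The conjugacy `x ↦ 1 - x` exchanges `b` and `1 - b`, so let `b < 1/2`. For large `a` there are
disjoint intervals, `K` near `0` and `L` around the fixed point `b`, such that the image of `K`
covers `L` and that of `L` covers `K ∪ L` (`gameMap_eventually_chaotic`). Any itinerary that never
stays in `K` twice in a row is then realised. The itinerary with one visit to `K` every `n` steps
gives least period `n ≥ 2`; the fixed point `b` gives period `1`. For chaos, each binary sequence is
coded by visits to `K` at sparse times. Differing codes separate orbits infinitely often by the gap
between `K` and `L`. In `L` the distance to `b` at least doubles at each step
(`two_mul_abs_sub_le`), so a long run in `L` must begin very close to `b`, and shared long runs make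
any two coded orbits proximal. -/

open Set Filter Topology

/-! ### Realising itineraries by compactness. -/

section Itineraries

variable {X : Type*}

/-- Every finite itinerary through sets that cover each other successively is realised. -/
theorem exists_finite_itinerary {f : X → X} (n : ℕ) :
    ∀ (A : ℕ → Set X), (∀ i, (A i).Nonempty) → (∀ i, A (i + 1) ⊆ f '' A i) →
      ∃ x, ∀ i ≤ n, f^[i] x ∈ A i := by
  induction n with
  | zero =>
    intro A hne _
    obtain ⟨x, hx⟩ := hne 0
    exact ⟨x, fun i hi => by obtain rfl := Nat.le_zero.1 hi; exact hx⟩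
  | succ n ih =>
    intro A hne hcov
    obtain ⟨y, hy⟩ := ih (fun i => A (i + 1)) (fun i => hne _) (fun i => hcov _)
    obtain ⟨x, hx, rfl⟩ := hcov 0 (hy 0 (Nat.zero_le _))
    refine ⟨x, fun i hi => ?_⟩
    cases i with
    | zero => exact hx
    | succ i => exact hy i (Nat.le_of_succ_le_succ hi)

/-- Infinite itineraries through closed sets are realised in compact spaces. -/
theorem exists_itinerary [TopologicalSpace X] [CompactSpace X] {f : X → X} (hf : Continuous f)
    {A : ℕ → Set X} (hcl : ∀ i, IsClosed (A i)) (hne : ∀ i, (A i).Nonempty)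
    (hcov : ∀ i, A (i + 1) ⊆ f '' A i) : ∃ x, ∀ i, f^[i] x ∈ A i := by
  let C : ℕ → Set X := fun n => ⋂ i ∈ Iic n, f^[i] ⁻¹' A i
  have hC : ∀ n, IsClosed (C n) := fun n =>
    isClosed_biInter fun i _ => (hcl i).preimage (hf.iterate i)
  obtain ⟨x, hx⟩ := IsCompact.nonempty_iInter_of_sequence_nonempty_isCompact_isClosed C
    (fun n => biInter_subset_biInter_left (Iic_subset_Iic.2 n.le_succ))
    (fun n => by
      obtain ⟨x, hx⟩ := exists_finite_itinerary n A hne hcov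
      exact ⟨x, mem_iInter₂.2 hx⟩)
    (hC 0).isCompact hC
  exact ⟨x, fun i => mem_iInter₂.1 (mem_iInter.1 hx i) i (mem_Iic.2 le_rfl)⟩

end Itineraries

/-! ### Scrambled sets from coverings with expansion. -/

section Chaos

/-- The times at which the itinerary coded by `α` visits the first set. -/
def visitTimes (α : ℕ → Bool) : Set ℕ :=
  {n | ∃ j, n = (j + 1) ^ 2 ∧ α (Nat.unpair j).1 = true}

/-- Positive squares are never consecutive. This rules out the transition from `K` to `K`, which the
covering relations do not provide. -/
theorem not_succ_mem_visitTimes {α : ℕ → Bool} {n : ℕ} (h : n ∈ visitTimes α) :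
    n + 1 ∉ visitTimes α := by
  rintro ⟨k, hk, -⟩
  obtain ⟨j, rfl, -⟩ := h
  rcases le_or_gt k j with h | h
  · nlinarith [Nat.pow_le_pow_left (Nat.succ_le_succ h) 2]
  · nlinarith [Nat.pow_le_pow_left (Nat.succ_le_succ (Nat.succ_le_of_lt h)) 2]

theorem sq_mem_visitTimes {α : ℕ → Bool} {j : ℕ} :
    (j + 1) ^ 2 ∈ visitTimes α ↔ α (Nat.unpair j).1 = true := by
  constructor
  · rintro ⟨k, hk, h⟩
    have : j + 1 = k + 1 := Nat.pow_left_injective two_ne_zero hk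
    obtain rfl : j = k := by omega
    exact h
  · exact fun h => ⟨j, rfl, h⟩

/-- The next square after `(j + 1) ^ 2` is `2 * j + 3` later, so every code has a run of `j + 1`
times in `L` here, whatever `α` is. -/
theorem not_mem_visitTimes_of_run {α : ℕ → Bool} {j i : ℕ} (hi : i ≤ j) :
    (j + 1) ^ 2 + 1 + i ∉ visitTimes α := by
  rintro ⟨k, hk, -⟩
  rcases le_or_gt k j with h | h
  · nlinarith [Nat.pow_le_pow_left (Nat.succ_le_succ h) 2]
  · nlinarith [Nat.pow_le_pow_left (Nat.succ_le_succ (Nat.succ_le_of_lt h)) 2]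

theorem pow_mul_dist_le_of_run {X : Type*} [PseudoMetricSpace X] {f : X → X} {L : Set X} {b : X}
    (hexp : ∀ x ∈ L, f x ∈ L → 2 * dist x b ≤ dist (f x) b) (m : ℕ) :
    ∀ x, (∀ i ≤ m, f^[i] x ∈ L) → 2 ^ m * dist x b ≤ dist (f^[m] x) b := by
  induction m with
  | zero => intro x _; simp
  | succ m ih =>
    intro x hx
    have h1 := hexp x (hx 0 (Nat.zero_le _)) (hx 1 (by omega))
    have h2 := ih (f x) fun i hi => hx (i + 1) (by omega)
    calc (2 : ℝ) ^ (m + 1) * dist x b = 2 ^ m * (2 * dist x b) := by ring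
      _ ≤ 2 ^ m * dist (f x) b := by gcongr
      _ ≤ _ := h2

variable {X : Type*} [MetricSpace X] [CompactSpace X]

theorem isLiYorkePair_of_frequently {f : X → X} {x y : X} {δ : ℝ} (hδ : 0 < δ)
    (hclose : ∀ ε > 0, ∃ᶠ n in atTop, dist (f^[n] x) (f^[n] y) ≤ ε)
    (hfar : ∃ᶠ n in atTop, δ ≤ dist (f^[n] x) (f^[n] y)) : IsLiYorkePair f x y := by
  have hbdd : IsBoundedUnder (· ≤ ·) atTop fun n : ℕ => dist (f^[n] x) (f^[n] y) :=
    isBoundedUnder_of ⟨Metric.diam (univ : Set X), fun n =>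
      Metric.dist_le_diam_of_mem isCompact_univ.isBounded (mem_univ _) (mem_univ _)⟩
  have hbdd' : IsBoundedUnder (· ≥ ·) atTop fun n : ℕ => dist (f^[n] x) (f^[n] y) :=
    isBoundedUnder_of ⟨0, fun n => dist_nonneg⟩
  refine ⟨le_antisymm (le_of_forall_pos_le_add fun ε hε => ?_) ?_, ?_⟩
  · rw [zero_add]
    exact liminf_le_of_frequently_le (hclose ε hε) hbdd'
  · exact le_liminf_of_le hbdd.isCoboundedUnder_ge (Eventually.of_forall fun n => dist_nonneg)
  · exact hδ.trans_le (le_limsup_of_frequently_le hfar hbdd)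

/-- Two disjoint closed sets `K`, `L` with `f K ⊇ L`, `f L ⊇ K ∪ L`, such that `f` expands distances
to some point along orbit segments in `L`, force Li-Yorke chaos. -/
theorem isLiYorkeChaotic_of_covering {f : X → X} (hf : Continuous f) {K L : Set X} {b : X}
    (hK : IsClosed K) (hL : IsClosed L) (hKne : K.Nonempty) (hdisj : Disjoint K L)
    (hKL : L ⊆ f '' K) (hLK : K ⊆ f '' L) (hLL : L ⊆ f '' L)
    (hexp : ∀ x ∈ L, f x ∈ L → 2 * dist x b ≤ dist (f x) b) : IsLiYorkeChaotic f := by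
  classical
  have hLne : L.Nonempty := by
    obtain ⟨x, hx⟩ := hKne
    obtain ⟨y, hy, -⟩ := hLK hx
    exact ⟨y, hy⟩
  let A : (ℕ → Bool) → ℕ → Set X := fun α n => if n ∈ visitTimes α then K else L
  have hA : ∀ α, ∃ x, ∀ i, f^[i] x ∈ A α i := by
    intro α
    refine exists_itinerary hf (fun i => ?_) (fun i => ?_) (fun i => ?_)
    · dsimp only [A]; split_ifs <;> assumption
    · dsimp only [A]; split_ifs <;> assumption
    · dsimp only [A]
      by_cases h : i ∈ visitTimes α
      · rwa [if_pos h, if_neg (not_succ_mem_visitTimes h)]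
      · rw [if_neg h]; split_ifs <;> assumption
  choose p hp using hA
  obtain ⟨δ, hδ, hgap⟩ : ∃ δ > 0, ∀ x ∈ K, ∀ y ∈ L, δ ≤ dist x y := by
    obtain ⟨r, hr, h⟩ := hdisj.exists_thickenings hK.isCompact hL
    refine ⟨r, hr, fun x hx y hy => ?_⟩
    by_contra! hlt
    exact disjoint_left.1 h (Metric.mem_thickening_iff.2 ⟨x, hx, by rwa [dist_comm]⟩)
      (Metric.self_subset_thickening hr L hy)
  have hpair : ∀ α β, α ≠ β → IsLiYorkePair f (p α) (p β) := by
    intro α β hne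
    refine isLiYorkePair_of_frequently hδ (fun ε hε => ?_) ?_
    · rw [frequently_atTop]
      intro N
      have hlim : Tendsto (fun m : ℕ => (2 : ℝ) ^ m) atTop atTop :=
        tendsto_pow_atTop_atTop_of_one_lt one_lt_two
      obtain ⟨j, hjN, hj⟩ := ((eventually_ge_atTop N).and
        (hlim.eventually_ge_atTop (2 * Metric.diam (univ : Set X) / ε))).exists
      -- At the start of this common run both orbits are within `diam / 2 ^ j` of `b`.
      refine ⟨(j + 1) ^ 2 + 1, by nlinarith, ?_⟩
      have key : ∀ γ, 2 ^ j * dist (f^[(j + 1) ^ 2 + 1] (p γ)) b ≤ Metric.diam (univ : Set X) := by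
        intro γ
        refine (pow_mul_dist_le_of_run hexp j _ fun i hi => ?_).trans
          (Metric.dist_le_diam_of_mem isCompact_univ.isBounded (mem_univ _) (mem_univ _))
        rw [← Function.iterate_add_apply, add_comm]
        have := hp γ ((j + 1) ^ 2 + 1 + i)
        dsimp only [A] at this
        rwa [if_neg (not_mem_visitTimes_of_run hi)] at this
      have h1 := key α
      have h2 := key β
      rw [div_le_iff₀ hε] at hj
      have h3 := dist_triangle_right (f^[(j + 1) ^ 2 + 1] (p α)) (f^[(j + 1) ^ 2 + 1] (p β)) b
      have hpos : (0 : ℝ) < 2 ^ j := by positivity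
      nlinarith
    · rw [frequently_atTop]
      intro N
      obtain ⟨k, hk⟩ := Function.ne_iff.1 hne
      -- The pairing makes coordinate `k` recur at arbitrarily late squares.
      refine ⟨(Nat.pair k N + 1) ^ 2, ?_, ?_⟩
      · nlinarith [Nat.right_le_pair k N]
      · have h1 := hp α ((Nat.pair k N + 1) ^ 2)
        have h2 := hp β ((Nat.pair k N + 1) ^ 2)
        simp only [A, sq_mem_visitTimes, Nat.unpair_pair] at h1 h2
        cases ha : α k <;> cases hb : β k <;> simp only [ha, hb] at h1 h2 hk
        · exact absurd rfl hk
        · rw [dist_comm]; exact hgap _ (by simpa using h2) _ (by simpa using h1)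
        · exact hgap _ (by simpa using h1) _ (by simpa using h2)
        · exact absurd rfl hk
  have hinj : Function.Injective p := by
    intro α β h
    by_contra hne
    have := (hpair α β hne).2
    simp [h] at this
  refine ⟨hf, range p, fun hcount => ?_, ?_⟩
  · have : Countable (ℕ → Bool) := by
      rw [← image_univ] at hcount
      exact countable_univ_iff.1 (countable_of_injective_of_countable_image hinj.injOn hcount)
    obtain ⟨e, he⟩ := exists_surjective_nat (ℕ → Bool)
    obtain ⟨n, hn⟩ := he fun k => !(e k k)
    simpa using congrFun hn n
  · rintro _ ⟨α, rfl⟩ _ ⟨β, rfl⟩ hne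
    exact hpair α β fun h => hne (h ▸ rfl)

end Chaos

/-! ### Periodic points from interval coverings. -/

section Periods

variable {α β : Type*} [ConditionallyCompleteLinearOrder α] [TopologicalSpace α] [OrderTopology α]
  [DenselyOrdered α] [LinearOrder β] [TopologicalSpace β] [OrderClosedTopology β]

/-- Take `u` to be the last point with value `g s` and `v` the first one after it with value `g t`.
Leaving the range in between would, by the intermediate value theorem, contradict one of these
choices. -/
theorem exists_subinterval_mapsTo_Icc {g : α → β} {s t : α} (hst : s ≤ t)
    (hg : ContinuousOn g (Icc s t)) (hle : g s ≤ g t) :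
    ∃ u v, s ≤ u ∧ u ≤ v ∧ v ≤ t ∧ g u = g s ∧ g v = g t ∧
      ∀ z ∈ Icc u v, g z ∈ Icc (g s) (g t) := by
  have hU : IsCompact (Icc s t ∩ g ⁻¹' {g s}) :=
    isCompact_Icc.of_isClosed_subset
      (hg.preimage_isClosed_of_isClosed isClosed_Icc isClosed_singleton) inter_subset_left
  obtain ⟨u, ⟨⟨hsu, hut⟩, hgu⟩, hmax⟩ := hU.exists_isGreatest ⟨s, ⟨le_rfl, hst⟩, rfl⟩
  have hg' : ContinuousOn g (Icc u t) := hg.mono (Icc_subset_Icc_left hsu)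
  have hV : IsCompact (Icc u t ∩ g ⁻¹' {g t}) :=
    isCompact_Icc.of_isClosed_subset
      (hg'.preimage_isClosed_of_isClosed isClosed_Icc isClosed_singleton) inter_subset_left
  obtain ⟨v, ⟨⟨huv, hvt⟩, hgv⟩, hmin⟩ := hV.exists_isLeast ⟨t, ⟨hut, le_rfl⟩, rfl⟩
  rw [mem_preimage, mem_singleton_iff] at hgu hgv
  refine ⟨u, v, hsu, huv, hvt, hgu, hgv, fun z hz => ⟨?_, ?_⟩⟩
  · by_contra! hlt
    obtain ⟨w, hw, hgw⟩ := intermediate_value_Icc hz.2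
      (hg'.mono (Icc_subset_Icc hz.1 hvt)) ⟨hlt.le, hgv ▸ hle⟩
    have hwu : w ≤ u := hmax ⟨⟨hsu.trans (hz.1.trans hw.1), hw.2.trans hvt⟩, hgw⟩
    have hzu : z = u := le_antisymm (hw.1.trans hwu) hz.1
    rw [hzu, hgu] at hlt
    exact hlt.false
  · by_contra! hlt
    obtain ⟨w, hw, hgw⟩ := intermediate_value_Icc hz.1
      (hg'.mono (Icc_subset_Icc_right (hz.2.trans hvt))) ⟨hgu ▸ hle, hlt.le⟩
    have hvw : v ≤ w := hmin ⟨⟨hw.1, hw.2.trans (hz.2.trans hvt)⟩, hgw⟩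
    have hzv : z = v := le_antisymm hz.2 (hvw.trans hw.2)
    rw [hzv, hgv] at hlt
    exact hlt.false

/-- If an interval covers `[p, q]`, some subinterval is mapped exactly onto `[p, q]`. -/
theorem exists_subinterval_image_eq_Icc {g : α → β} {s t : α} {p q : β} (hpq : p ≤ q)
    (hg : ContinuousOn g (Icc s t)) (hcov : Icc p q ⊆ g '' Icc s t) :
    ∃ u v, s ≤ u ∧ u ≤ v ∧ v ≤ t ∧ g '' Icc u v = Icc p q := by
  obtain ⟨x, hx, hxp⟩ := hcov (left_mem_Icc.2 hpq)
  obtain ⟨y, hy, hyq⟩ := hcov (right_mem_Icc.2 hpq)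
  rcases le_total x y with hxy | hxy
  · have hsub : Icc x y ⊆ Icc s t := Icc_subset_Icc hx.1 hy.2
    obtain ⟨u, v, hxu, huv, hvy, hgu, hgv, hmap⟩ :=
      exists_subinterval_mapsTo_Icc hxy (hg.mono hsub) (by rwa [hxp, hyq])
    rw [hxp] at hgu hmap
    rw [hyq] at hgv hmap
    refine ⟨u, v, hx.1.trans hxu, huv, hvy.trans hy.2, (MapsTo.image_subset hmap).antisymm ?_⟩
    have := intermediate_value_Icc huv
      (hg.mono (Icc_subset_Icc (hx.1.trans hxu) (hvy.trans hy.2)))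
    rwa [hgu, hgv] at this
  · have hsub : Icc y x ⊆ Icc s t := Icc_subset_Icc hy.1 hx.2
    -- Reversing the order of the codomain reduces this case to the preceding one.
    obtain ⟨u, v, hxu, huv, hvy, hgu, hgv, hmap⟩ :=
      exists_subinterval_mapsTo_Icc (β := βᵒᵈ) (g := g) hxy (hg.mono hsub)
        (show g x ≤ g y by rwa [hxp, hyq])
    have hgu' : g u = q := hgu.trans hyq
    have hgv' : g v = p := hgv.trans hxp
    have hmap' : ∀ z ∈ Icc u v, g z ∈ Icc p q := fun z hz => by
      have := hmap z hz
      rw [← hxp, ← hyq]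
      exact ⟨this.2, this.1⟩
    refine ⟨u, v, hy.1.trans hxu, huv, hvy.trans hx.2, (MapsTo.image_subset hmap').antisymm ?_⟩
    have := intermediate_value_Icc' huv
      (hg.mono (Icc_subset_Icc (hy.1.trans hxu) (hvy.trans hx.2)))
    rwa [hgu', hgv'] at this

theorem exists_subinterval_itinerary {f : α → α} (hf : Continuous f) {p q : ℕ → α}
    (hpq : ∀ i, p i ≤ q i)
    (hcov : ∀ i, Icc (p (i + 1)) (q (i + 1)) ⊆ f '' Icc (p i) (q i)) (n : ℕ) :
    ∃ u v, u ≤ v ∧ (∀ i ≤ n, ∀ x ∈ Icc u v, f^[i] x ∈ Icc (p i) (q i)) ∧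
      f^[n] '' Icc u v = Icc (p n) (q n) := by
  induction n with
  | zero =>
    refine ⟨p 0, q 0, hpq 0, fun i hi x hx => ?_, by simp⟩
    obtain rfl := Nat.le_zero.1 hi
    exact hx
  | succ n ih =>
    obtain ⟨u, v, -, hit, him⟩ := ih
    have hc : Icc (p (n + 1)) (q (n + 1)) ⊆ f^[n + 1] '' Icc u v := by
      rw [Function.iterate_succ', image_comp, him]
      exact hcov n
    obtain ⟨u', v', hu, huv', hv, heq⟩ :=
      exists_subinterval_image_eq_Icc (hpq _) (hf.iterate (n + 1)).continuousOn hc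
    refine ⟨u', v', huv', fun i hi x hx => ?_, heq⟩
    rcases hi.lt_or_eq with h | rfl
    · exact hit i (Nat.le_of_lt_succ h) x (Icc_subset_Icc hu hv hx)
    · exact heq ▸ mem_image_of_mem _ hx

theorem exists_isFixedPt_of_subset_image {g : α → α} {u v : α} (huv : u ≤ v)
    (hg : ContinuousOn g (Icc u v)) (hcov : Icc u v ⊆ g '' Icc u v) :
    ∃ x ∈ Icc u v, g x = x := by
  obtain ⟨s, hs, hgs⟩ := hcov (left_mem_Icc.2 huv)
  obtain ⟨t, ht, hgt⟩ := hcov (right_mem_Icc.2 huv)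
  exact isPreconnected_Icc.intermediate_value₂ hs ht hg continuousOn_id
    (show g s ≤ s from hgs ▸ hs.1) (show t ≤ g t from hgt ▸ ht.2)

/-- Two disjoint intervals `K`, `L` with `f K ⊇ L`, `f L ⊇ K ∪ L` force points of every least period
at least two. -/
theorem exists_minimalPeriod_eq_of_covering {f : α → α} (hf : Continuous f) {k k' l l' : α}
    (hk : k ≤ k') (hl : l ≤ l') (hdisj : Disjoint (Icc k k') (Icc l l'))
    (hKL : Icc l l' ⊆ f '' Icc k k') (hLK : Icc k k' ⊆ f '' Icc l l')
    (hLL : Icc l l' ⊆ f '' Icc l l') {n : ℕ} (hn : 2 ≤ n) :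
    ∃ x, Function.minimalPeriod f x = n := by
  let p : ℕ → α := fun i => if n ∣ i then k else l
  let q : ℕ → α := fun i => if n ∣ i then k' else l'
  have hpq : ∀ i, p i ≤ q i := fun i => by
    dsimp only [p, q]; split_ifs <;> assumption
  have hcov : ∀ i, Icc (p (i + 1)) (q (i + 1)) ⊆ f '' Icc (p i) (q i) := fun i => by
    dsimp only [p, q]
    by_cases h : n ∣ i
    · have h' : ¬ n ∣ i + 1 := fun h' => by
        have := Nat.le_of_dvd one_pos ((Nat.dvd_add_right h).1 h')
        omega
      simpa only [if_pos h, if_neg h'] using hKL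
    · rw [if_neg h, if_neg h]
      split_ifs <;> assumption
  obtain ⟨u, v, huv, hit, him⟩ := exists_subinterval_itinerary hf hpq hcov n
  have h0 : ∀ x ∈ Icc u v, x ∈ Icc k k' := fun x hx => by
    simpa [p, q] using hit 0 (Nat.zero_le _) x hx
  have hsub : Icc u v ⊆ f^[n] '' Icc u v := by
    rw [him]
    simp only [p, q, dvd_refl, if_true]
    exact h0
  obtain ⟨x, hx, hfx⟩ := exists_isFixedPt_of_subset_image huv (hf.iterate n).continuousOn hsub
  have hper : Function.IsPeriodicPt f n x := hfx
  refine ⟨x, le_antisymm (hper.minimalPeriod_le (by omega)) ?_⟩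
  by_contra! hlt
  have hpos := hper.minimalPeriod_pos (by omega)
  -- A return to `x` before time `n` would happen while the itinerary is in `L`, although `x` lies
  -- in `K`.
  have hmem := hit _ hlt.le x hx
  have hnd : ¬ n ∣ Function.minimalPeriod f x := fun h => by
    have := Nat.le_of_dvd hpos h
    omega
  rw [Function.iterate_minimalPeriod] at hmem
  simp only [p, q, if_neg hnd] at hmem
  exact disjoint_left.1 hdisj (h0 x hx) hmem

end Periods

/-! ### Symmetry, expansion and coverings for the game map. -/

section GameMap

theorem continuous_gameMap (a b : ℝ) : Continuous (gameMap a b) := by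
  refine Continuous.subtype_mk ?_ _
  unfold gameMapFormula
  exact Continuous.div (by fun_prop) (by fun_prop) fun x => (gameMapFormula_denom_pos a b x.2).ne'

theorem gameMapFormula_one_sub (a b : ℝ) {x : ℝ} (hx : x ∈ Icc (0 : ℝ) 1) :
    gameMapFormula a (1 - b) (1 - x) = 1 - gameMapFormula a b x := by
  have h1 := gameMapFormula_denom_pos a b hx
  have h2 := gameMapFormula_denom_pos a (1 - b) (x := 1 - x)
    ⟨sub_nonneg.2 hx.2, by linarith [hx.1]⟩
  have hE : Real.exp (a * (1 - x - (1 - b))) * Real.exp (a * (x - b)) = 1 := by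
    rw [← Real.exp_add, ← Real.exp_zero]
    congr 1
    ring
  unfold gameMapFormula
  rw [one_sub_div h1.ne', div_eq_div_iff h2.ne' h1.ne']
  linear_combination (-(1 - x) * x) * hE

theorem gameMap_symm (a b : ℝ) (x : Icc (0 : ℝ) 1) :
    gameMap a (1 - b) (unitInterval.symm x) = unitInterval.symm (gameMap a b x) :=
  Subtype.ext (gameMapFormula_one_sub a b x.2)

theorem gameMap_iterate_symm (a b : ℝ) (n : ℕ) (x : Icc (0 : ℝ) 1) :
    (gameMap a (1 - b))^[n] (unitInterval.symm x) = unitInterval.symm ((gameMap a b)^[n] x) :=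
  ((show Function.Semiconj unitInterval.symm (gameMap a b) (gameMap a (1 - b)) from
    fun x => (gameMap_symm a b x).symm).iterate_right n x).symm

theorem dist_unitInterval_symm (x y : Icc (0 : ℝ) 1) :
    dist (unitInterval.symm x) (unitInterval.symm y) = dist x y := by
  simp only [Subtype.dist_eq, unitInterval.coe_symm_eq]
  exact dist_sub_left 1 _ _

theorem HasPeriodicOrbitsOfAllPeriods.gameMap_one_sub {a b : ℝ}
    (h : HasPeriodicOrbitsOfAllPeriods (gameMap a b)) :
    HasPeriodicOrbitsOfAllPeriods (gameMap a (1 - b)) := by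
  intro n hn
  obtain ⟨x, hx⟩ := h n hn
  refine ⟨unitInterval.symm x, hx ▸ ?_⟩
  refine Function.minimalPeriod_eq_minimalPeriod_iff.2 fun m => ?_
  unfold Function.IsPeriodicPt Function.IsFixedPt
  rw [gameMap_iterate_symm]
  exact unitInterval.symm_bijective.injective.eq_iff

theorem IsLiYorkeChaotic.gameMap_one_sub {a b : ℝ} (h : IsLiYorkeChaotic (gameMap a b)) :
    IsLiYorkeChaotic (gameMap a (1 - b)) := by
  obtain ⟨-, S, hS, hscr⟩ := h
  have hinj := unitInterval.symm_bijective.injective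
  refine ⟨continuous_gameMap _ _, unitInterval.symm '' S,
    fun hc => hS (countable_of_injective_of_countable_image hinj.injOn hc), ?_⟩
  rintro _ ⟨x, hx, rfl⟩ _ ⟨y, hy, rfl⟩ hne
  have := hscr x hx y hy fun h => hne (h ▸ rfl)
  unfold IsLiYorkePair at this ⊢
  simpa only [gameMap_iterate_symm, dist_unitInterval_symm] using this

theorem gameMap_fixed {a b : ℝ} (hb0 : 0 < b) (hb1 : b < 1) :
    gameMap a b ⟨b, hb0.le, hb1.le⟩ = ⟨b, hb0.le, hb1.le⟩ := by
  ext
  simp [gameMap, gameMapFormula]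

theorem gameMapFormula_mem_Ioo (a b : ℝ) {x : ℝ} (hx : x ∈ Ioo (0 : ℝ) 1) :
    gameMapFormula a b x ∈ Ioo (0 : ℝ) 1 := by
  have hpos := gameMapFormula_denom_pos a b (Ioo_subset_Icc_self hx)
  have := mul_pos (sub_pos.2 hx.2) (Real.exp_pos (a * (x - b)))
  refine ⟨div_pos hx.1 hpos, ?_⟩
  rw [gameMapFormula, div_lt_one hpos]
  linarith

/-- In the log-odds coordinate the map merely subtracts `a * (x - b)`, which yields expansion for
large `a`. -/
theorem log_gameMapFormula_sub (a b : ℝ) {x : ℝ} (hx : x ∈ Ioo (0 : ℝ) 1) :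
    Real.log (gameMapFormula a b x) - Real.log (1 - gameMapFormula a b x) =
      Real.log x - Real.log (1 - x) - a * (x - b) := by
  have hpos := gameMapFormula_denom_pos a b (Ioo_subset_Icc_self hx)
  have h1 : 1 - gameMapFormula a b x =
      (1 - x) * Real.exp (a * (x - b)) / (x + (1 - x) * Real.exp (a * (x - b))) := by
    rw [gameMapFormula, one_sub_div hpos.ne']
    ring
  rw [h1, gameMapFormula, Real.log_div hx.1.ne' hpos.ne',
    Real.log_div (mul_pos (sub_pos.2 hx.2) (Real.exp_pos _)).ne' hpos.ne',
    Real.log_mul (sub_pos.2 hx.2).ne' (Real.exp_pos _).ne', Real.log_exp]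
  ring

theorem abs_log_sub_log_le {m x y : ℝ} (hm : 0 < m) (hx : m ≤ x) (hy : m ≤ y) :
    |Real.log x - Real.log y| ≤ m⁻¹ * |x - y| := by
  have key : ∀ {u v : ℝ}, m ≤ u → m ≤ v → Real.log u - Real.log v ≤ m⁻¹ * |u - v| := by
    intro u v hu hv
    have hu0 := hm.trans_le hu
    have hv0 := hm.trans_le hv
    rw [← Real.log_div hu0.ne' hv0.ne']
    calc Real.log (u / v) ≤ u / v - 1 := Real.log_le_sub_one_of_pos (div_pos hu0 hv0)
      _ = v⁻¹ * (u - v) := by field_simp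
      _ ≤ v⁻¹ * |u - v| := by gcongr; exact le_abs_self _
      _ ≤ m⁻¹ * |u - v| := by gcongr
  refine abs_sub_le_iff.2 ⟨key hx hy, ?_⟩
  rw [abs_sub_comm x y]
  exact key hy hx

/-- Away from the endpoints the map expands distances to `b` once `a` is large. -/
theorem two_mul_abs_sub_le {a b m m' x : ℝ} (hm : 0 < m) (hm' : 0 < m')
    (ha : 3 * (m⁻¹ + m'⁻¹) ≤ a) (hb : b ∈ Icc m (1 - m')) (hx : x ∈ Icc m (1 - m'))
    (hfx : gameMapFormula a b x ∈ Icc m (1 - m')) :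
    2 * |x - b| ≤ |gameMapFormula a b x - b| := by
  set y := gameMapFormula a b x with hy
  have hlip : ∀ z ∈ Icc m (1 - m'),
      |(Real.log z - Real.log (1 - z)) - (Real.log b - Real.log (1 - b))| ≤
        (m⁻¹ + m'⁻¹) * |z - b| := by
    intro z hz
    have h1 := abs_log_sub_log_le hm hz.1 hb.1
    have h2 := abs_log_sub_log_le (x := 1 - z) (y := 1 - b) hm' (by linarith [hz.2])
      (by linarith [hb.2])
    rw [show (1 - z) - (1 - b) = -(z - b) by ring, abs_neg] at h2
    calc _ = |(Real.log z - Real.log b) - (Real.log (1 - z) - Real.log (1 - b))| := by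
          congr 1; ring
      _ ≤ _ := abs_sub _ _
      _ ≤ _ := by linarith
  have hlog := log_gameMapFormula_sub a b (x := x) ⟨hm.trans_le hx.1, by linarith [hx.2]⟩
  rw [← hy] at hlog
  have h1 := hlip x hx
  have h2 := hlip y hfx
  have hM : 0 < m⁻¹ + m'⁻¹ := by positivity
  -- `a * (x - b)` is the difference of the log-odds of `x` and `y`. Both are compared with those of
  -- `b`, log-odds being Lipschitz on the interval.
  have h3 : a * |x - b| ≤ (m⁻¹ + m'⁻¹) * |x - b| + (m⁻¹ + m'⁻¹) * |y - b| := by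
    rw [← abs_of_pos (show 0 < a by linarith), ← abs_mul]
    calc _ = |((Real.log x - Real.log (1 - x)) - (Real.log b - Real.log (1 - b))) -
          ((Real.log y - Real.log (1 - y)) - (Real.log b - Real.log (1 - b)))| := by
          congr 1; rw [hlog]; ring
      _ ≤ _ := abs_sub _ _
      _ ≤ _ := add_le_add h1 h2
  have h4 := mul_le_mul_of_nonneg_right ha (abs_nonneg (x - b))
  refine le_of_mul_le_mul_left ?_ hM
  linarith

theorem le_gameMapFormula {a b x y : ℝ} (hx : x ∈ Icc (0 : ℝ) 1)
    (h : y * (1 - x) ≤ (1 - y) * x * Real.exp (a * (b - x))) : y ≤ gameMapFormula a b x := by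
  have hE : Real.exp (a * (b - x)) * Real.exp (a * (x - b)) = 1 := by
    rw [← Real.exp_add, ← Real.exp_zero]
    congr 1
    ring
  rw [gameMapFormula, le_div_iff₀ (gameMapFormula_denom_pos a b hx)]
  have := mul_le_mul_of_nonneg_right h (Real.exp_pos (a * (x - b))).le
  rw [mul_assoc _ (Real.exp _), hE] at this
  linarith

theorem gameMapFormula_le {a b x y : ℝ} (hx : x ∈ Icc (0 : ℝ) 1)
    (h : (1 - y) * x * Real.exp (a * (b - x)) ≤ y * (1 - x)) : gameMapFormula a b x ≤ y := by
  have hE : Real.exp (a * (b - x)) * Real.exp (a * (x - b)) = 1 := by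
    rw [← Real.exp_add, ← Real.exp_zero]
    congr 1
    ring
  rw [gameMapFormula, div_le_iff₀ (gameMapFormula_denom_pos a b hx)]
  have := mul_le_mul_of_nonneg_right h (Real.exp_pos (a * (x - b))).le
  rw [mul_assoc _ (Real.exp _), hE] at this
  linarith

theorem eventually_le_exp_mul (C : ℝ) {r : ℝ} (hr : 0 < r) :
    ∀ᶠ a : ℝ in atTop, C ≤ Real.exp (a * r) :=
  (Real.tendsto_exp_atTop.comp (tendsto_id.atTop_mul_const hr)).eventually_ge_atTop C

/-- Here `K = [x₀, b/4]` and `L = [b/2, b + 1/2]`. The right end `b + 1/2` is the midpoint of `2 *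
b` and `1`: its image is of order `exp (-a/2)`, which drops below `x₀`, of order `exp (-a * b)`,
exactly because `b < 1/2`. -/
theorem gameMap_eventually_chaotic {b : ℝ} (hb0 : 0 < b) (hb : b < 1 / 2) :
    ∀ᶠ a : ℝ in atTop,
      HasPeriodicOrbitsOfAllPeriods (gameMap a b) ∧ IsLiYorkeChaotic (gameMap a b) := by
  have hd : 0 < 1 / 2 - b := by linarith
  filter_upwards [eventually_ge_atTop (3 * ((b / 2)⁻¹ + (1 / 2 - b)⁻¹)),
    eventually_le_exp_mul 2 hb0,
    eventually_le_exp_mul ((1 / 2 - b)⁻¹ * (b / 2)⁻¹) (r := b / 2) (by linarith),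
    eventually_le_exp_mul ((1 / 2 - b)⁻¹ * (b / 4)⁻¹) (r := 3 * b / 4) (by linarith),
    eventually_le_exp_mul ((1 / 2 - b)⁻¹ * (b / 2)⁻¹) hd] with a ha h2 hl hk hr
  have ha0 : 0 < a := lt_of_lt_of_le (by positivity) ha
  -- The derivative at `0` is `exp (a * b)`; this scale brings the image of `x₀` down to at most `b
  -- / 2`.
  set x₀ : ℝ := b / 2 * Real.exp (-(a * b)) with hx₀
  have hexp : Real.exp (a * b) * Real.exp (-(a * b)) = 1 := by
    rw [← Real.exp_add, add_neg_cancel, Real.exp_zero]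
  have hx₀pos : 0 < x₀ := by positivity
  have hx₀le : x₀ ≤ b / 4 := by
    have := mul_le_mul_of_nonneg_right h2 (Real.exp_pos (-(a * b))).le
    rw [hexp] at this
    nlinarith
  rw [← mul_inv, inv_le_iff_one_le_mul₀ (by positivity)] at hl hk hr
  have I0 : x₀ ∈ Icc (0 : ℝ) 1 := ⟨hx₀pos.le, by linarith⟩
  have I1 : b / 4 ∈ Icc (0 : ℝ) 1 := ⟨by linarith, by linarith⟩
  have I2 : b / 2 ∈ Icc (0 : ℝ) 1 := ⟨by linarith, by linarith⟩
  have I3 : b + 1 / 2 ∈ Icc (0 : ℝ) 1 := ⟨by linarith, by linarith⟩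
  have F0 : gameMapFormula a b x₀ ≤ b / 2 := by
    refine gameMapFormula_le I0 ?_
    have hle : Real.exp (a * (b - x₀)) ≤ Real.exp (a * b) :=
      Real.exp_le_exp.2 (by nlinarith)
    have h3 : x₀ * Real.exp (a * (b - x₀)) ≤ b / 2 := by
      calc _ ≤ x₀ * Real.exp (a * b) := by gcongr
        _ = b / 2 * (Real.exp (a * b) * Real.exp (-(a * b))) := by rw [hx₀]; ring
        _ = b / 2 := by rw [hexp, mul_one]
    calc _ = (1 - b / 2) * (x₀ * Real.exp (a * (b - x₀))) := by ring
      _ ≤ (1 - b / 2) * (b / 2) := by gcongr; linarith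
      _ ≤ _ := by nlinarith
  have F1 : b + 1 / 2 ≤ gameMapFormula a b (b / 4) := by
    refine le_gameMapFormula I1 ?_
    rw [show b - b / 4 = 3 * b / 4 by ring]
    nlinarith
  have F2 : b + 1 / 2 ≤ gameMapFormula a b (b / 2) := by
    refine le_gameMapFormula I2 ?_
    rw [show b - b / 2 = b / 2 by ring]
    nlinarith
  have F3 : gameMapFormula a b (b + 1 / 2) ≤ x₀ := by
    refine gameMapFormula_le I3 ?_
    have hsplit : Real.exp (a * (1 / 2 - b)) * Real.exp (a * (b - (b + 1 / 2))) =
        Real.exp (-(a * b)) := by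
      rw [← Real.exp_add]
      congr 1
      ring
    have h3 : Real.exp (a * (b - (b + 1 / 2))) ≤ x₀ * (1 / 2 - b) := by
      have := mul_le_mul_of_nonneg_right hr (Real.exp_pos (a * (b - (b + 1 / 2)))).le
      calc _ = 1 * Real.exp (a * (b - (b + 1 / 2))) := (one_mul _).symm
        _ ≤ _ := this
        _ = b / 2 * (1 / 2 - b) *
            (Real.exp (a * (1 / 2 - b)) * Real.exp (a * (b - (b + 1 / 2)))) := by ring
        _ = _ := by rw [hsplit, hx₀]; ring
    have h4 : (1 - x₀) * (b + 1 / 2) ≤ 1 :=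
      mul_le_one₀ (by linarith) (by linarith) (by linarith)
    calc _ ≤ 1 * Real.exp (a * (b - (b + 1 / 2))) := by gcongr
      _ ≤ x₀ * (1 / 2 - b) := by rwa [one_mul]
      _ = _ := by ring
  let k : Icc (0 : ℝ) 1 := ⟨x₀, I0⟩
  let k' : Icc (0 : ℝ) 1 := ⟨b / 4, I1⟩
  let l : Icc (0 : ℝ) 1 := ⟨b / 2, I2⟩
  let l' : Icc (0 : ℝ) 1 := ⟨b + 1 / 2, I3⟩
  have hkk : k ≤ k' := hx₀le
  have hkl : k' < l := show b / 4 < b / 2 by linarith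
  have hll : l ≤ l' := show b / 2 ≤ b + 1 / 2 by linarith
  have hcont := continuous_gameMap a b
  have hdisj : Disjoint (Icc k k') (Icc l l') :=
    disjoint_left.2 fun x hx hx' => (hx.2.trans_lt hkl).not_ge hx'.1
  have hKL : Icc l l' ⊆ gameMap a b '' Icc k k' :=
    (Icc_subset_Icc (show gameMap a b k ≤ l from F0) (show l' ≤ gameMap a b k' from F1)).trans
      (intermediate_value_Icc hkk hcont.continuousOn)
  have hL : Icc k l' ⊆ gameMap a b '' Icc l l' :=
    (Icc_subset_Icc (show gameMap a b l' ≤ k from F3) (show l' ≤ gameMap a b l from F2)).trans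
      (intermediate_value_Icc' hll hcont.continuousOn)
  have hLK : Icc k k' ⊆ gameMap a b '' Icc l l' :=
    (Icc_subset_Icc_right (hkl.le.trans hll)).trans hL
  have hLL : Icc l l' ⊆ gameMap a b '' Icc l l' :=
    (Icc_subset_Icc_left (hkk.trans hkl.le)).trans hL
  refine ⟨fun n hn => ?_, ?_⟩
  · rcases hn.eq_or_lt with rfl | hn
    · exact ⟨_, Function.minimalPeriod_eq_one_iff_isFixedPt.2
        (gameMap_fixed (a := a) hb0 (by linarith))⟩
    · exact exists_minimalPeriod_eq_of_covering hcont hkk hll hdisj hKL hLK hLL hn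
  · refine isLiYorkeChaotic_of_covering (b := ⟨b, hb0.le, by linarith⟩) hcont isClosed_Icc
      isClosed_Icc (nonempty_Icc.2 hkk) hdisj hKL hLK hLL fun x hx hfx => ?_
    have hcoe : ∀ z ∈ Icc l l', (z : ℝ) ∈ Icc (b / 2) (1 - (1 / 2 - b)) := fun z hz =>
      ⟨hz.1, (show (z : ℝ) ≤ b + 1 / 2 from hz.2).trans (by linarith)⟩
    exact two_mul_abs_sub_le (half_pos hb0) hd ha ⟨by linarith, by linarith⟩ (hcoe x hx)
      (hcoe _ hfx)

end GameMap

theorem mainTheorem3 (b : ℝ) (hb0 : 0 < b) (hb1 : b < 1) (hb : b ≠ 1 / 2) :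
    ∃ a₀ : ℝ, 0 < a₀ ∧ ∀ a : ℝ, a₀ < a →
      HasPeriodicOrbitsOfAllPeriods (gameMap a b) ∧ IsLiYorkeChaotic (gameMap a b) := by
  have key : ∀ᶠ a : ℝ in atTop,
      HasPeriodicOrbitsOfAllPeriods (gameMap a b) ∧ IsLiYorkeChaotic (gameMap a b) := by
    rcases hb.lt_or_gt with h | h
    · exact gameMap_eventually_chaotic hb0 h
    · filter_upwards [gameMap_eventually_chaotic (b := 1 - b) (by linarith) (by linarith)]
        with a ha
      have h1 := ha.1.gameMap_one_sub
      have h2 := ha.2.gameMap_one_sub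
      rw [sub_sub_cancel] at h1 h2
      exact ⟨h1, h2⟩
  obtain ⟨a₀, ha₀⟩ := eventually_atTop.1 key
  exact ⟨max a₀ 1, by positivity, fun a ha => ha₀ a ((le_max_left _ _).trans ha.le)⟩
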